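/- Let $n\ge 6$ and let $W$ be the Coxeter group of type $E_n$: its Coxeter generators are $s_0,s_1,\dots,s_{n-1}$, with $m_{ij}=3$ if $\{i,j\}$ is an edge of the graph consisting of the path $1-2-3-\cdots-(n-1)$ and one further vertex $0$ joined only to $3$, and $m_{ij}=2$ for all other $i\ne j$. (For $n\ge 9$ the group $W$ is infinite.) Let $V$ be the real vector space with basis the simple roots $\gamma_0,\dots,\gamma_{n-1}$ and with the Coxeter form $B(\gamma_i,\gamma_j)=-\cos(\pi/m_{ij})$, where $m_{ii}=1$. Let $W$ act on $V$ by $s_i v=v-2B(v,\gamma_i)\gamma_i$, and let $\Phi=\{w\gamma_i\}$ be the root system. For $w\in W$ let $\Phi(w)$ be the set of positive roots that $w$ sends to negative roots. A reduced expression $s_{i_1}\cdots s_{i_k}$ for $w$ has the root sequence $(r_1,\dots,r_k)$, where $r_1=\gamma_{i_k}$ and $r_q=s_{i_k}\cdots s_{i_{k-q+2}}(\gamma_{i_{k-q+1}})$ for $2\le q\le k$. A contractible triple of $w$ is a subset of $\Phi(w)$ of the form $\{\alpha,\beta,\alpha+\beta\}$ whose elements appear consecutively, in some order, in the root sequence of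 some reduced expression for $w$. The element $w$ is called maximally clustered if, for any two contractible triples $T,T'$ of $w$ with $T\cap T'\neq\emptyset$, the highest roots (the roots of greatest height, where the height of a root is the sum of its coefficients in the basis of simple roots) of $T$ and $T'$ agree. Then $W$ has only finitely many maximally clustered elements. -/

import Mathlib

/-- The edges of the Coxeter graph of type `E_n`, listed with the smaller vertex first. The vertices
are `0, 1, …, n - 1`; the vertices `1 - 2 - 3 - ⋯ - (n - 1)` form a path, and `0` is joined to `3`
only. -/
def CoxeterMatrix.typeEEdge (i j : ℕ) : Prop :=
  (1 ≤ i ∧ i + 1 = j) ∨ (i = 0 ∧ j = 3)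

instance CoxeterMatrix.typeEEdge.decidable (i j : ℕ) :
    Decidable (CoxeterMatrix.typeEEdge i j) := by
  unfold CoxeterMatrix.typeEEdge
  infer_instance

/-- The Coxeter matrix of type `E_n` (`n` generators; meant for `n ≥ 6`). -/
def CoxeterMatrix.typeE (n : ℕ) : CoxeterMatrix (Fin n) where
  M := Matrix.of fun i j =>
    if i = j then 1
    else if CoxeterMatrix.typeEEdge i j ∨ CoxeterMatrix.typeEEdge j i then 3
    else 2
  isSymm := by
    ext i j
    simp only [Matrix.transpose_apply, Matrix.of_apply, eq_comm (a := i) (b := j),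
      or_comm (a := CoxeterMatrix.typeEEdge i j)]
  diagonal := by intro i; simp
  off_diagonal := by
    intro i j h
    simp only [Matrix.of_apply, if_neg h]
    split_ifs <;> norm_num

/-- A Coxeter matrix is simply laced if `m_{ij} ∈ {2, 3}` for all `i ≠ j`. -/
class CoxeterMatrix.IsSimplyLaced {B : Type*} (M : CoxeterMatrix B) : Prop where
  eq_two_or_eq_three : ∀ i j : B, i ≠ j → M i j = 2 ∨ M i j = 3

instance CoxeterMatrix.typeE_isSimplyLaced (n : ℕ) : (CoxeterMatrix.typeE n).IsSimplyLaced where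
  eq_two_or_eq_three := by
    intro i j h
    change (if i = j then 1 else
      if CoxeterMatrix.typeEEdge i j ∨ CoxeterMatrix.typeEEdge j i then 3 else 2) = 2 ∨
      (if i = j then 1 else
      if CoxeterMatrix.typeEEdge i j ∨ CoxeterMatrix.typeEEdge j i then 3 else 2) = 3
    rw [if_neg h]
    split_ifs <;> simp

namespace CoxeterMatrix

variable {B : Type*} [Fintype B] [DecidableEq B]

/-- The simple root `γ_i`, the `i`-th standard basis vector of `V = ℝ^B`. -/
noncomputable def simpleRoot (i : B) : B → ℝ := Pi.single i 1

/-- The Coxeter form: the bilinear form on `V` with `B(γ_i, γ_j) = - cos (π / m_{ij})`. -/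
noncomputable def coxeterForm (M : CoxeterMatrix B) : LinearMap.BilinForm ℝ (B → ℝ) :=
  Matrix.toBilin' (Matrix.of fun i j => - Real.cos (Real.pi / (M i j : ℝ)))

/-- The reflection `v ↦ v - 2 B(v, γ_i) γ_i` of `V`. -/
noncomputable def simpleReflection (M : CoxeterMatrix B) (i : B) : Module.End ℝ (B → ℝ) :=
  LinearMap.id - (2 : ℝ) • (M.coxeterForm.flip (simpleRoot i)).smulRight (simpleRoot i)

theorem simpleReflection_apply (M : CoxeterMatrix B) (i : B) (v : B → ℝ) :
    M.simpleReflection i v = v - (2 * M.coxeterForm v (simpleRoot i)) • simpleRoot i := by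
  simp [simpleReflection, mul_smul]

theorem coxeterForm_simpleRoot (M : CoxeterMatrix B) (i j : B) :
    M.coxeterForm (simpleRoot i) (simpleRoot j) = - Real.cos (Real.pi / (M i j : ℝ)) := by
  simp [coxeterForm, simpleRoot]

/-- The simple reflections satisfy the Coxeter relations of a simply laced Coxeter group. -/
theorem isLiftable_simpleReflection (M : CoxeterMatrix B) [hM : M.IsSimplyLaced] :
    M.IsLiftable M.simpleReflection := by
  intro i j
  have hii : ∀ k, M.coxeterForm (simpleRoot k) (simpleRoot k) = 1 := by
    intro k; rw [coxeterForm_simpleRoot]; simp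
  by_cases hij : i = j
  · subst hij
    rw [M.diagonal, pow_one]
    refine LinearMap.ext fun v => ?_
    simp only [Module.End.mul_apply, simpleReflection_apply, Module.End.one_apply, map_sub,
      map_smul, hii]
    module
  · have hji : M.coxeterForm (simpleRoot j) (simpleRoot i) =
        M.coxeterForm (simpleRoot i) (simpleRoot j) := by
      rw [coxeterForm_simpleRoot, coxeterForm_simpleRoot, M.symmetric]
    rcases hM.eq_two_or_eq_three i j hij with h | h
    · have h0 : M.coxeterForm (simpleRoot i) (simpleRoot j) = 0 := by
        rw [coxeterForm_simpleRoot, h]; simp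
      rw [h0] at hji
      rw [h, pow_two]
      refine LinearMap.ext fun v => ?_
      simp only [Module.End.mul_apply, simpleReflection_apply, Module.End.one_apply, map_sub,
        map_smul, hii, h0, hji]
      module
    · have h0 : M.coxeterForm (simpleRoot i) (simpleRoot j) = -(1 / 2) := by
        rw [coxeterForm_simpleRoot, h]; simp
      rw [h0] at hji
      rw [h, pow_succ, pow_two]
      refine LinearMap.ext fun v => ?_
      simp only [Module.End.mul_apply, simpleReflection_apply, Module.End.one_apply, map_sub,
        map_smul, hii, h0, hji]
      module

end CoxeterMatrix

namespace CoxeterSystem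

variable {B : Type*} [Fintype B] [DecidableEq B] {M : CoxeterMatrix B} [M.IsSimplyLaced]
  {W : Type*} [Group W] (cs : CoxeterSystem M W)

/-- The reflection representation of `W` on `V`, with `s_i v = v - 2 B(v, γ_i) γ_i`. -/
noncomputable def reflectionRep : Representation ℝ W (B → ℝ) :=
  cs.lift ⟨M.simpleReflection, M.isLiftable_simpleReflection⟩

/-- The root system `Φ = {w γ_i}`. -/
def roots : Set (B → ℝ) :=
  {α | ∃ (w : W) (i : B), α = cs.reflectionRep w (CoxeterMatrix.simpleRoot i)}

/-- The positive roots: all coefficients are nonnegative. -/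
def posRoots : Set (B → ℝ) := {α | α ∈ cs.roots ∧ ∀ i, 0 ≤ α i}

/-- The negative roots: all coefficients are nonpositive. -/
def negRoots : Set (B → ℝ) := {α | α ∈ cs.roots ∧ ∀ i, α i ≤ 0}

/-- `Φ(w)`, the set of positive roots sent to negative roots by `w`. -/
def inversionRoots (w : W) : Set (B → ℝ) :=
  {α | α ∈ cs.posRoots ∧ cs.reflectionRep w α ∈ cs.negRoots}

/-- The root sequence of a word `i_1 ⋯ i_n`, namely `(r_1, …, r_n)` with `r_1 = γ_{i_n}` and
`r_q = s_{i_n} ⋯ s_{i_{n-q+2}} γ_{i_{n-q+1}}`. In particular the last entry is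
`r_n = (s_{i_2} ⋯ s_{i_n})⁻¹ γ_{i_1}` and the others form the root sequence of `i_2 ⋯ i_n`. -/
noncomputable def rootSeq : List B → List (B → ℝ)
  | [] => []
  | i :: ω => rootSeq ω ++ [cs.reflectionRep (cs.wordProd ω)⁻¹ (CoxeterMatrix.simpleRoot i)]

/-- `r` is a root sequence for `w`: the root sequence of some reduced expression for `w`. -/
def IsRootSeqFor (w : W) (r : List (B → ℝ)) : Prop :=
  ∃ ω : List B, cs.IsReduced ω ∧ cs.wordProd ω = w ∧ cs.rootSeq ω = r

/-- An inversion triple of `w`: a subset of `Φ(w)` of the form `{α, β, α + β}`. -/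
def IsInversionTriple (w : W) (T : Set (B → ℝ)) : Prop :=
  T ⊆ cs.inversionRoots w ∧ ∃ α β : B → ℝ, T = {α, β, α + β}

/-- A contractible triple of `w`: an inversion triple whose elements appear consecutively, in some
order, in some root sequence for `w`. -/
def IsContractibleTriple (w : W) (T : Set (B → ℝ)) : Prop :=
  cs.IsInversionTriple w T ∧
    ∃ r : List (B → ℝ), cs.IsRootSeqFor w r ∧
      ∃ a b c : B → ℝ, [a, b, c] <:+: r ∧ T = {a, b, c}

/-- The height of a root: the sum of its coefficients in the basis of simple roots. -/
def rootHeight {B : Type*} [Fintype B] (α : B → ℝ) : ℝ := ∑ i, α i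

/-- `γ` is the highest root in `T`: the element of `T` of greatest height. -/
def IsHighestRoot {B : Type*} [Fintype B] (T : Set (B → ℝ)) (γ : B → ℝ) : Prop :=
  γ ∈ T ∧ ∀ δ ∈ T, rootHeight δ ≤ rootHeight γ

/-- `w` is maximally clustered: any two intersecting contractible triples of `w` have the same
highest root. -/
def IsMaximallyClustered (w : W) : Prop :=
  ∀ T T' : Set (B → ℝ), cs.IsContractibleTriple w T → cs.IsContractibleTriple w T' →
    (T ∩ T').Nonempty →
      ∀ γ γ' : B → ℝ, IsHighestRoot T γ → IsHighestRoot T' γ' → γ = γ'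

end CoxeterSystem

open CoxeterMatrix

/-! A braid `i j i` in a reduced word, possibly interrupted by letters commuting with `i`,
contributes three roots whose highest is the one of `j`. If three consecutive occurrences of `j`
have exactly one neighbour of `j` in each gap, the two braids share the root of the middle `j` but
have different highest roots. Hence no reduced word of a maximally clustered element contains this
pattern (`AvoidsAdjacentBraids`).

Among the reduced words choose one with least sum of letters. A braid `i k i` with `k < i` could be
replaced by `k i k`, so two occurrences of `i` whose gap has no neighbour above `i` are separated by
at least two neighbours. Together with the patterns that one or two braid moves turn into adjacent
braids, this gives purely combinatorial constraints on words in `ℕ`, inherited by factors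
(`IsSparseWord`).

In a sparse word the largest letter `t` occurs at most three times. For `t ≥ 3`, four occurrences
would form a `HasInteriorGap` configuration, which descends from `i + 1` to `i`
(`HasInteriorGap.pred`) and is impossible at the branch vertex `3` (`not_hasInteriorGap_three`).
Cutting at the largest letter then bounds the length by induction on the number of letters. -/

/-- The number of letters of the word `y` that are joined to `i` by an edge of the graph. -/
def CoxeterMatrix.adjCount {B : Type*} (M : CoxeterMatrix B) (i : B) (y : List B) : ℕ :=
  y.countP (fun k => M i k = 3)

namespace CoxeterSystem

/-! ### Braid moves in reduced words -/

section Words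

variable {B : Type*} {M : CoxeterMatrix B} {W : Type*} [Group W] (cs : CoxeterSystem M W)

theorem simple_braid {i j : B} (h : M i j = 3) :
    cs.simple i * cs.simple j * cs.simple i = cs.simple j * cs.simple i * cs.simple j := by
  have := cs.simple_mul_simple_pow i j
  rw [h, pow_succ, pow_two] at this
  have h2 : (cs.simple i * cs.simple j * cs.simple i) *
      (cs.simple j * cs.simple i * cs.simple j) = 1 := by
    rw [← this]; group
  rw [mul_eq_one_iff_eq_inv] at h2
  rw [h2]; simp [mul_inv_rev, mul_assoc]

theorem IsReduced.of_append_left {cs : CoxeterSystem M W} {a b : List B}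
    (h : cs.IsReduced (a ++ b)) : cs.IsReduced a := by
  simpa using h.take a.length

theorem IsReduced.of_append_right {cs : CoxeterSystem M W} {a b : List B}
    (h : cs.IsReduced (a ++ b)) : cs.IsReduced b := by
  simpa using h.drop a.length

theorem commute_simple_of_ne_three [hM : M.IsSimplyLaced] {i j : B} (h : M i j ≠ 3) :
    Commute (cs.simple i) (cs.simple j) := by
  by_cases hij : i = j
  · rw [hij]
  · have h2 : M i j = 2 := (hM.eq_two_or_eq_three i j hij).resolve_right h
    have := cs.simple_mul_simple_pow i j
    rw [h2, pow_two, mul_eq_one_iff_eq_inv] at this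
    rw [mul_inv_rev, inv_simple, inv_simple] at this
    exact this

theorem ne_three_of_adjCount_eq_zero {i k : B} {y : List B} (h : M.adjCount i y = 0)
    (hk : k ∈ y) : M i k ≠ 3 := by
  simpa using List.countP_eq_zero.1 h k hk

theorem commute_wordProd [M.IsSimplyLaced] {i : B} {y : List B} (h : M.adjCount i y = 0) :
    Commute (cs.simple i) (cs.wordProd y) := by
  rw [wordProd]
  apply Commute.list_prod_right
  intro x hx
  obtain ⟨k, hk, rfl⟩ := List.mem_map.1 hx
  exact cs.commute_simple_of_ne_three (ne_three_of_adjCount_eq_zero h hk)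

theorem exists_of_adjCount_eq_one {i : B} {y : List B} (h : M.adjCount i y = 1) :
    ∃ y₁ k y₂, y = y₁ ++ k :: y₂ ∧ M i k = 3 ∧ M.adjCount i y₁ = 0 ∧ M.adjCount i y₂ = 0 := by
  induction y with
  | nil => simp [adjCount] at h
  | cons a y ih =>
    by_cases ha : M i a = 3
    · refine ⟨[], a, y, rfl, ha, rfl, ?_⟩
      simpa [adjCount, List.countP_cons, ha] using h
    · obtain ⟨y₁, k, y₂, rfl, hk, h1, h2⟩ := ih (by simpa [adjCount, List.countP_cons, ha] using h)
      exact ⟨a :: y₁, k, y₂, rfl, hk, by simpa [adjCount, List.countP_cons, ha] using h1, h2⟩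

/-- Two occurrences of `i` in a reduced word are separated by a letter joined to `i`. -/
theorem IsReduced.adjCount_ne_zero [M.IsSimplyLaced] {cs : CoxeterSystem M W} {a y b : List B} {i : B}
    (h : cs.IsReduced (a ++ i :: (y ++ i :: b))) : M.adjCount i y ≠ 0 := by
  intro h0
  have h1 : cs.IsReduced (i :: (y ++ [i])) := by
    apply IsReduced.of_append_left (b := b)
    simpa using h.of_append_right
  have e : cs.wordProd (i :: (y ++ [i])) = cs.wordProd y := by
    rw [wordProd_cons, wordProd_append, wordProd_singleton, ← mul_assoc,
      (cs.commute_wordProd h0).eq, simple_mul_simple_cancel_right]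
  have := h1.eq
  have h2 := cs.length_wordProd_le y
  rw [e] at this
  simp at this
  omega

theorem wordProd_gather [M.IsSimplyLaced] {i j : B} (a b : List B) {y₁ y₂ : List B}
    (h1 : M.adjCount i y₁ = 0) (h2 : M.adjCount i y₂ = 0) :
    cs.wordProd (a ++ i :: (y₁ ++ j :: (y₂ ++ i :: b)))
      = cs.wordProd (a ++ (y₁ ++ i :: j :: i :: (y₂ ++ b))) := by
  simp only [wordProd_append, wordProd_cons]
  have c1 := (cs.commute_wordProd h1).eq
  have c2 := (cs.commute_wordProd h2).eq
  simp only [← mul_assoc]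
  rw [mul_assoc _ (cs.simple i) (cs.wordProd y₁), c1, mul_assoc _ (cs.wordProd y₂) (cs.simple i),
    ← c2]
  simp only [← mul_assoc]

/-- Both `i` commute past the letters of the gaps to reach `j`; then the braid relation applies. -/
theorem wordProd_flip [M.IsSimplyLaced] {i j : B} (a b : List B) {y₁ y₂ : List B} (hij : M i j = 3)
    (h1 : M.adjCount i y₁ = 0) (h2 : M.adjCount i y₂ = 0) :
    cs.wordProd (a ++ i :: (y₁ ++ j :: (y₂ ++ i :: b)))
      = cs.wordProd (a ++ (y₁ ++ j :: i :: j :: (y₂ ++ b))) := by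
  rw [cs.wordProd_gather a b h1 h2]
  have := cs.simple_braid hij
  simp only [mul_assoc] at this
  simp only [wordProd_append, wordProd_cons]
  simp only [← mul_assoc]
  congr 2
  simp only [mul_assoc]
  rw [this]

theorem IsReduced.of_wordProd_eq {cs : CoxeterSystem M W} {ω ω' : List B} (h : cs.IsReduced ω)
    (he : cs.wordProd ω = cs.wordProd ω') (hl : ω.length = ω'.length) : cs.IsReduced ω' := by
  rw [IsReduced, ← he, h.eq, hl]

/-- No reduced word for `w` contains three consecutive occurrences of a letter `j` such that both
gaps between them contain exactly one letter joined to `j`. -/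
def AvoidsAdjacentBraids (w : W) : Prop :=
  ∀ (a : List B) (j : B) (y y' b : List B),
    cs.IsReduced (a ++ j :: (y ++ j :: (y' ++ j :: b))) →
    cs.wordProd (a ++ j :: (y ++ j :: (y' ++ j :: b))) = w →
    M.adjCount j y = 1 → M.adjCount j y' ≠ 1

/-- Flipping the right-hand braid `i j i` to `j i j` removes `i` from the gap after the first `j`,
leaving `y₀ ++ y₁`, and creates a next gap consisting of `i` alone. -/
theorem AvoidsAdjacentBraids.adjCount_ne_one_of_right [M.IsSimplyLaced]
    {cs : CoxeterSystem M W} {a y₀ y₁ c₁ c₂ : List B} {i j : B}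
    (h : cs.AvoidsAdjacentBraids
      (cs.wordProd (a ++ j :: (y₀ ++ i :: (y₁ ++ j :: (c₁ ++ i :: c₂))))))
    (hr : cs.IsReduced (a ++ j :: (y₀ ++ i :: (y₁ ++ j :: (c₁ ++ i :: c₂)))))
    (hij : M i j = 3) (h1 : M.adjCount i y₁ = 0) (h2 : M.adjCount i c₁ = 0) :
    M.adjCount j (y₀ ++ y₁) ≠ 1 := by
  intro h3
  have hji : M j i = 3 := M.symmetric i j ▸ hij
  have e := cs.wordProd_flip (a ++ j :: y₀) c₂ hij h1 h2
  simp only [List.append_assoc, List.cons_append] at e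
  have e' : a ++ j :: (y₀ ++ (y₁ ++ j :: i :: j :: (c₁ ++ c₂)))
      = a ++ j :: ((y₀ ++ y₁) ++ j :: ([i] ++ j :: (c₁ ++ c₂))) := by simp
  rw [e'] at e
  refine h _ _ _ _ _ (hr.of_wordProd_eq e ?_) e.symm h3 ?_
  · simp; omega
  · simp [adjCount, hji]

theorem AvoidsAdjacentBraids.adjCount_ne_one_of_left [M.IsSimplyLaced]
    {cs : CoxeterSystem M W} {a y₀ y₁ c₁ b : List B} {i j : B}
    (h : cs.AvoidsAdjacentBraids
      (cs.wordProd (a ++ i :: (c₁ ++ j :: (y₁ ++ i :: (y₀ ++ j :: b))))))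
    (hr : cs.IsReduced (a ++ i :: (c₁ ++ j :: (y₁ ++ i :: (y₀ ++ j :: b)))))
    (hij : M i j = 3) (h1 : M.adjCount i y₁ = 0) (h2 : M.adjCount i c₁ = 0) :
    M.adjCount j (y₁ ++ y₀) ≠ 1 := by
  intro h3
  have hji : M j i = 3 := M.symmetric i j ▸ hij
  have e := cs.wordProd_flip a (y₀ ++ j :: b) hij h2 h1
  have e' : a ++ (c₁ ++ j :: i :: j :: (y₁ ++ (y₀ ++ j :: b)))
      = (a ++ c₁) ++ j :: ([i] ++ j :: ((y₁ ++ y₀) ++ j :: b)) := by simp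
  rw [e'] at e
  refine h _ _ _ _ _ (hr.of_wordProd_eq e ?_) e.symm ?_ h3
  · simp; omega
  · simp [adjCount, hji]

/-- Flipping the right-hand braid reduces this to the one-sided case on the left. -/
theorem AvoidsAdjacentBraids.adjCount_ne_one_of_left_right [M.IsSimplyLaced]
    {cs : CoxeterSystem M W} {a a₁ y₀ y₁ y₂ c₁ c₂ : List B} {i j : B}
    (h : cs.AvoidsAdjacentBraids (cs.wordProd
      (a ++ i :: (a₁ ++ j :: (y₀ ++ i :: (y₁ ++ i :: (y₂ ++ j :: (c₁ ++ i :: c₂))))))))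
    (hr : cs.IsReduced
      (a ++ i :: (a₁ ++ j :: (y₀ ++ i :: (y₁ ++ i :: (y₂ ++ j :: (c₁ ++ i :: c₂)))))))
    (hij : M i j = 3) (h1 : M.adjCount i a₁ = 0) (h2 : M.adjCount i y₀ = 0)
    (h3 : M.adjCount i y₂ = 0) (h4 : M.adjCount i c₁ = 0) :
    M.adjCount j (y₀ ++ (y₁ ++ y₂)) ≠ 1 := by
  have e := cs.wordProd_flip (a ++ i :: (a₁ ++ j :: (y₀ ++ i :: y₁))) c₂ hij h3 h4
  simp only [List.append_assoc, List.cons_append] at e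
  rw [e] at h
  have e' : a ++ i :: (a₁ ++ j :: (y₀ ++ i :: (y₁ ++ (y₂ ++ j :: i :: j :: (c₁ ++ c₂)))))
      = a ++ i :: (a₁ ++ j :: (y₀ ++ i :: ((y₁ ++ y₂) ++ j :: (i :: j :: (c₁ ++ c₂))))) := by simp
  rw [e'] at h e
  exact h.adjCount_ne_one_of_left (hr.of_wordProd_eq e (by simp; omega)) hij h2 h1

end Words

/-! ### Roots contributed by the letters of a reduced word -/

section Roots

variable {B : Type*} [Fintype B] [DecidableEq B] {M : CoxeterMatrix B} [hM : M.IsSimplyLaced]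
  {W : Type*} [Group W] (cs : CoxeterSystem M W)

theorem reflectionRep_simple_apply (i : B) (v : B → ℝ) :
    cs.reflectionRep (cs.simple i) v
      = v - (2 * M.coxeterForm v (simpleRoot i)) • simpleRoot i := by
  rw [reflectionRep, cs.lift_apply_simple, simpleReflection_apply]

theorem reflectionRep_simple_self (i : B) :
    cs.reflectionRep (cs.simple i) (simpleRoot i) = -simpleRoot i := by
  rw [reflectionRep_simple_apply, coxeterForm_simpleRoot]
  simp only [M.diagonal, Nat.cast_one, div_one, Real.cos_pi, neg_neg]
  module

theorem reflectionRep_simple_of_eq_two {i j : B} (h : M i j = 2) :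
    cs.reflectionRep (cs.simple j) (simpleRoot i) = simpleRoot i := by
  rw [reflectionRep_simple_apply, coxeterForm_simpleRoot, h]
  simp

theorem reflectionRep_simple_of_eq_three {i j : B} (h : M i j = 3) :
    cs.reflectionRep (cs.simple j) (simpleRoot i) = simpleRoot i + simpleRoot j := by
  rw [reflectionRep_simple_apply, coxeterForm_simpleRoot, h]
  simp

/-- If right multiplication by `s_i` lengthens `w`, then `w γ_i` has nonnegative coefficients. -/
theorem reflectionRep_simpleRoot_nonneg (w : W) (i : B)
    (h : cs.length w < cs.length (w * cs.simple i)) :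
    0 ≤ cs.reflectionRep w (simpleRoot i) := by
  induction hn : cs.length w using Nat.strong_induction_on generalizing w i with
  | _ n ih =>
    subst hn
    by_cases hw : w = 1
    · subst hw
      simp [simpleRoot]
    obtain ⟨j, hj⟩ := cs.exists_rightDescent_of_ne_one hw
    rw [cs.isRightDescent_iff] at hj
    have hij : i ≠ j := by rintro rfl; omega
    obtain ⟨v, rfl⟩ : ∃ v, w = v * cs.simple j := ⟨w * cs.simple j, by simp⟩
    rw [cs.simple_mul_simple_cancel_right] at hj
    have hvj : cs.reflectionRep (v * cs.simple j) (simpleRoot i)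
        = cs.reflectionRep v (cs.reflectionRep (cs.simple j) (simpleRoot i)) := by
      rw [map_mul]; rfl
    rw [hvj]
    -- Writing `w = v s_j`, the root `w γ_i` is `v γ_i` if `m_{ij} = 2` and `v γ_i + v γ_j` if
    -- `m_{ij} = 3`. In the latter case, if `s_i` shortens `v = u s_i`, the sum collapses to `u
    -- γ_j`.
    rcases hM.eq_two_or_eq_three i j hij with h2 | h3
    · rw [cs.reflectionRep_simple_of_eq_two h2]
      refine ih _ (by omega) v i ?_ rfl
      rcases cs.length_mul_simple v i with h' | h'
      · omega
      · exfalso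
        have hc : v * cs.simple j * cs.simple i = v * cs.simple i * cs.simple j := by
          have := (cs.commute_simple_of_ne_three (i := i) (j := j) (by omega)).eq
          rw [mul_assoc, mul_assoc, this]
        rw [hc] at h
        have := cs.length_mul_simple (v * cs.simple i) j
        omega
    · rw [cs.reflectionRep_simple_of_eq_three h3, map_add]
      rcases cs.length_mul_simple v i with h' | h'
      · exact add_nonneg (ih _ (by omega) v i (by omega) rfl)
          (ih _ (by omega) v j (by omega) rfl)
      · obtain ⟨u, rfl⟩ : ∃ u, v = u * cs.simple i := ⟨v * cs.simple i, by simp⟩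
        rw [cs.simple_mul_simple_cancel_right] at h'
        have hu : ∀ x, cs.reflectionRep (u * cs.simple i) x
            = cs.reflectionRep u (cs.reflectionRep (cs.simple i) x) := by
          intro x; rw [map_mul]; rfl
        rw [← map_add, hu, map_add, cs.reflectionRep_simple_self,
          cs.reflectionRep_simple_of_eq_three (M.symmetric i j ▸ h3)]
        rw [show -simpleRoot i + (simpleRoot j + simpleRoot i) = simpleRoot j by abel]
        refine ih _ (by omega) u j ?_ rfl
        rcases cs.length_mul_simple u j with h4 | h4
        · omega
        -- If `s_j` shortened `u`, then `w s_i = u s_j s_i s_j` would be shorter than `w = u s_i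
        -- s_j`.
        · exfalso
          have hc : u * cs.simple i * cs.simple j * cs.simple i
              = u * cs.simple j * cs.simple i * cs.simple j := by
            have := cs.simple_braid h3
            simp only [mul_assoc] at this ⊢
            rw [this]
          rw [hc] at h
          have := cs.length_mul_simple (u * cs.simple j) i
          have := cs.length_mul_simple (u * cs.simple j * cs.simple i) j
          omega

/-- The root contributed to a root sequence by a letter `i` that is followed by the word `v`. -/
noncomputable def letterRoot (i : B) (v : List B) : B → ℝ :=
  cs.reflectionRep (cs.wordProd v)⁻¹ (simpleRoot i)

theorem letterRoot_cons (i k : B) (v : List B) :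
    cs.letterRoot i (k :: v)
      = cs.reflectionRep (cs.wordProd v)⁻¹ (cs.reflectionRep (cs.simple k) (simpleRoot i)) := by
  rw [letterRoot, wordProd_cons, mul_inv_rev, map_mul, inv_simple]; rfl

theorem letterRoot_append (i : B) (u v : List B) :
    cs.letterRoot i (u ++ v)
      = cs.reflectionRep (cs.wordProd v)⁻¹ (cs.letterRoot i u) := by
  rw [letterRoot, wordProd_append, mul_inv_rev, map_mul]; rfl

theorem letterRoot_nonneg {i : B} {v : List B} (h : cs.IsReduced (i :: v)) :
    0 ≤ cs.letterRoot i v := by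
  apply cs.reflectionRep_simpleRoot_nonneg
  have h1 : cs.IsReduced v := IsReduced.of_append_right (a := [i]) h
  have e : (cs.wordProd v)⁻¹ * cs.simple i = (cs.wordProd (i :: v))⁻¹ := by
    rw [wordProd_cons, mul_inv_rev, inv_simple]
  rw [e, length_inv, length_inv, h.eq, h1.eq]
  simp

theorem reflectionRep_simpleRoot_nonneg_of_isReduced {i : B} {u : List B}
    (h : cs.IsReduced (u ++ [i])) : 0 ≤ cs.reflectionRep (cs.wordProd u) (simpleRoot i) := by
  apply cs.reflectionRep_simpleRoot_nonneg
  have h1 : cs.IsReduced u := h.of_append_left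
  have e : cs.wordProd u * cs.simple i = cs.wordProd (u ++ [i]) := by
    rw [wordProd_append, wordProd_singleton]
  rw [e, h.eq, h1.eq]
  simp

theorem reflectionRep_wordProd_letterRoot (u : List B) (i : B) (v : List B) :
    cs.reflectionRep (cs.wordProd (u ++ i :: v)) (cs.letterRoot i v)
      = -cs.reflectionRep (cs.wordProd u) (simpleRoot i) := by
  have : cs.reflectionRep (cs.wordProd (u ++ i :: v)) (cs.letterRoot i v)
      = cs.reflectionRep (cs.wordProd (u ++ i :: v) * (cs.wordProd v)⁻¹) (simpleRoot i) := by
    rw [map_mul]; rfl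
  rw [this, wordProd_append, wordProd_cons, mul_assoc, mul_assoc, mul_inv_cancel, mul_one, map_mul,
    ← map_neg, ← cs.reflectionRep_simple_self]
  rfl

theorem letterRoot_mem_inversionRoots {u v : List B} {i : B}
    (h : cs.IsReduced (u ++ i :: v)) :
    cs.letterRoot i v ∈ cs.inversionRoots (cs.wordProd (u ++ i :: v)) := by
  refine ⟨⟨⟨_, i, rfl⟩, fun k => cs.letterRoot_nonneg h.of_append_right k⟩,
    ⟨⟨cs.wordProd (u ++ i :: v) * (cs.wordProd v)⁻¹, i, ?_⟩, fun k => ?_⟩⟩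
  · rw [map_mul]; rfl
  · rw [reflectionRep_wordProd_letterRoot]
    have h1 : cs.IsReduced (u ++ [i]) := by
      apply IsReduced.of_append_left (b := v)
      simpa using h
    have := cs.reflectionRep_simpleRoot_nonneg_of_isReduced h1 k
    simpa using this

/-- Distinct letters of a reduced word contribute distinct roots. -/
theorem letterRoot_ne {a c b : List B} {i k : B}
    (h : cs.IsReduced (a ++ i :: (c ++ k :: b))) :
    cs.letterRoot i (c ++ k :: b) ≠ cs.letterRoot k b := by
  intro he
  have h1 : cs.IsReduced (i :: c) := by
    apply IsReduced.of_append_left (b := k :: b)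
    simpa using h.of_append_right
  -- Cancelling `b` from equal roots, and then applying `s_k`, gives `-γ_k` as the root of `i` in
  -- the reduced word `i :: c`, contradicting nonnegativity.
  have h2 : cs.letterRoot i (c ++ [k]) = simpleRoot k := by
    have e : c ++ k :: b = (c ++ [k]) ++ b := by simp
    rw [e, letterRoot_append] at he
    have := congrArg (cs.reflectionRep (cs.wordProd b)) he
    simpa [letterRoot, ← Module.End.mul_apply, ← map_mul] using this
  rw [letterRoot_append, wordProd_singleton, inv_simple] at h2
  have h3 := congrArg (cs.reflectionRep (cs.simple k)) h2
  rw [cs.reflectionRep_simple_self, ← Module.End.mul_apply, ← map_mul, simple_mul_simple_self,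
    map_one, Module.End.one_apply] at h3
  have := cs.letterRoot_nonneg h1 k
  rw [h3] at this
  simp [simpleRoot] at this
  linarith

theorem exists_rootSeq_append (u v : List B) :
    ∃ r, cs.rootSeq (u ++ v) = cs.rootSeq v ++ r := by
  induction u with
  | nil => exact ⟨[], by simp⟩
  | cons i u ih =>
    obtain ⟨r, hr⟩ := ih
    refine ⟨r ++ [cs.letterRoot i (u ++ v)], ?_⟩
    rw [List.cons_append, rootSeq, hr, List.append_assoc]
    rfl

end Roots

/-! ### Braids as contractible triples -/

section Triples

variable {B : Type*} [Fintype B] [DecidableEq B] {M : CoxeterMatrix B} [hM : M.IsSimplyLaced]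
  {W : Type*} [Group W] (cs : CoxeterSystem M W)

/-- The three roots contributed by a factor `i j i` of a reduced word for `w`, from left to right
in the word. -/
def IsBraidTriple (w : W) (α β γ : B → ℝ) : Prop :=
  ∃ (u : List B) (i j : B) (v : List B), cs.IsReduced (u ++ i :: j :: i :: v) ∧
    cs.wordProd (u ++ i :: j :: i :: v) = w ∧ M i j = 3 ∧
    α = cs.letterRoot i (j :: i :: v) ∧ β = cs.letterRoot j (i :: v) ∧ γ = cs.letterRoot i v

theorem IsBraidTriple.add_eq {cs : CoxeterSystem M W} {w : W} {α β γ : B → ℝ}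
    (h : cs.IsBraidTriple w α β γ) : α + γ = β := by
  obtain ⟨u, i, j, v, -, -, hij, rfl, rfl, rfl⟩ := h
  have hji : M j i = 3 := M.symmetric i j ▸ hij
  rw [letterRoot_cons, letterRoot_cons, cs.reflectionRep_simple_of_eq_three hij,
    cs.reflectionRep_simple_of_eq_three hji, wordProd_cons, mul_inv_rev, inv_simple, map_mul,
    Module.End.mul_apply, map_add, cs.reflectionRep_simple_self,
    cs.reflectionRep_simple_of_eq_three hji, letterRoot, ← map_add]
  congr 1
  abel

theorem IsBraidTriple.mem_inversionRoots {cs : CoxeterSystem M W} {w : W} {α β γ : B → ℝ}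
    (h : cs.IsBraidTriple w α β γ) :
    α ∈ cs.inversionRoots w ∧ β ∈ cs.inversionRoots w ∧ γ ∈ cs.inversionRoots w := by
  obtain ⟨u, i, j, v, hr, rfl, hij, rfl, rfl, rfl⟩ := h
  refine ⟨cs.letterRoot_mem_inversionRoots hr, ?_, ?_⟩
  · have e : u ++ i :: j :: i :: v = (u ++ [i]) ++ j :: i :: v := by simp
    rw [e] at hr ⊢
    exact cs.letterRoot_mem_inversionRoots hr
  · have e : u ++ i :: j :: i :: v = (u ++ [i, j]) ++ i :: v := by simp
    rw [e] at hr ⊢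
    exact cs.letterRoot_mem_inversionRoots hr

theorem IsBraidTriple.isContractibleTriple {cs : CoxeterSystem M W} {w : W} {α β γ : B → ℝ}
    (h : cs.IsBraidTriple w α β γ) : cs.IsContractibleTriple w {α, β, γ} := by
  obtain ⟨hα, hβ, hγ⟩ := h.mem_inversionRoots
  have hadd := h.add_eq
  refine ⟨⟨?_, α, γ, ?_⟩, ?_⟩
  · rintro x (rfl | rfl | rfl) <;> assumption
  · rw [hadd, Set.pair_comm]
  · obtain ⟨u, i, j, v, hr, hw, hij, rfl, rfl, rfl⟩ := h
    -- A root sequence reads its word from right to left, so the three roots appear in reverse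
    -- order.
    refine ⟨_, ⟨_, hr, hw, rfl⟩, cs.letterRoot i v, cs.letterRoot j (i :: v),
      cs.letterRoot i (j :: i :: v), ?_, ?_⟩
    · obtain ⟨r, hr⟩ := cs.exists_rootSeq_append u (i :: j :: i :: v)
      rw [hr]
      exact ⟨cs.rootSeq v, r, by simp [rootSeq, letterRoot]⟩
    · ext x
      simp only [Set.mem_insert_iff, Set.mem_singleton_iff]
      tauto

theorem IsBraidTriple.isHighestRoot {cs : CoxeterSystem M W} {w : W} {α β γ : B → ℝ}
    (h : cs.IsBraidTriple w α β γ) : IsHighestRoot {α, β, γ} β := by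
  obtain ⟨hα, hβ, hγ⟩ := h.mem_inversionRoots
  have hadd := h.add_eq
  have hsum : rootHeight β = rootHeight α + rootHeight γ := by
    rw [← hadd]
    simp [rootHeight, Finset.sum_add_distrib]
  have h1 : 0 ≤ rootHeight α := Finset.sum_nonneg fun k _ => hα.1.2 k
  have h2 : 0 ≤ rootHeight γ := Finset.sum_nonneg fun k _ => hγ.1.2 k
  refine ⟨by simp, ?_⟩
  rintro x (rfl | rfl | rfl) <;> linarith

theorem IsMaximallyClustered.middle_eq {cs : CoxeterSystem M W} {w : W}
    (hw : cs.IsMaximallyClustered w) {α β γ α' β' γ' : B → ℝ}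
    (h : cs.IsBraidTriple w α β γ) (h' : cs.IsBraidTriple w α' β' γ') (he : γ = α') :
    β = β' :=
  hw _ _ h.isContractibleTriple h'.isContractibleTriple
    ⟨γ, by simp, by simp [he]⟩ _ _ h.isHighestRoot h'.isHighestRoot

theorem letterRoot_eq_simpleRoot {i : B} {y : List B} (h : M.adjCount i y = 0) (hi : i ∉ y) :
    cs.letterRoot i y = simpleRoot i := by
  induction y with
  | nil => simp [letterRoot]
  | cons k y ih =>
    have hk : M i k = 2 := by
      refine (hM.eq_two_or_eq_three i k ?_).resolve_right
        (ne_three_of_adjCount_eq_zero h List.mem_cons_self)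
      rintro rfl; exact hi List.mem_cons_self
    rw [letterRoot_cons, cs.reflectionRep_simple_of_eq_two hk]
    refine ih ?_ fun h' => hi (List.mem_cons_of_mem _ h')
    simpa [adjCount, List.countP_cons, hk] using h

/-- Gathering the interrupted braid into a factor `i j i` leaves its three roots unchanged:
reducedness keeps `i` out of the gaps, so their letters all fix `γ_i`. -/
theorem IsReduced.isBraidTriple {cs : CoxeterSystem M W} {a y₁ y₂ b : List B} {i j : B}
    (h : cs.IsReduced (a ++ i :: (y₁ ++ j :: (y₂ ++ i :: b)))) (hij : M i j = 3)
    (h1 : M.adjCount i y₁ = 0) (h2 : M.adjCount i y₂ = 0) :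
    cs.IsBraidTriple (cs.wordProd (a ++ i :: (y₁ ++ j :: (y₂ ++ i :: b))))
      (cs.letterRoot i (y₁ ++ j :: (y₂ ++ i :: b))) (cs.letterRoot j (y₂ ++ i :: b))
      (cs.letterRoot i b) := by
  have hi1 : i ∉ y₁ := by
    intro hi
    obtain ⟨p, q, rfl, -⟩ := List.eq_append_cons_of_mem hi
    refine IsReduced.adjCount_ne_zero (cs := cs) (a := a) (i := i) (y := p)
      (b := q ++ j :: (y₂ ++ i :: b)) (by simpa using h) ?_
    simp only [adjCount, List.countP_append] at h1 ⊢
    omega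
  have hi2 : i ∉ y₂ := by
    intro hi
    obtain ⟨p, q, rfl, -⟩ := List.eq_append_cons_of_mem hi
    refine IsReduced.adjCount_ne_zero (cs := cs) (a := a ++ i :: (y₁ ++ j :: p)) (i := i) (y := q)
      (b := b) (by simpa using h) ?_
    simp only [adjCount, List.countP_append, List.countP_cons] at h2 ⊢
    omega
  have c2 := (cs.commute_wordProd h2).eq
  have e : cs.wordProd (y₂ ++ i :: b) = cs.wordProd (i :: (y₂ ++ b)) := by
    rw [wordProd_append, wordProd_cons, wordProd_cons, wordProd_append, ← mul_assoc, ← mul_assoc, c2]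
  refine ⟨a ++ y₁, i, j, y₂ ++ b, ?_, ?_, hij, ?_, ?_, ?_⟩
  · refine h.of_wordProd_eq ?_ (by simp; omega)
    rw [cs.wordProd_gather a b h1 h2, List.append_assoc]
  · rw [cs.wordProd_gather a b h1 h2, List.append_assoc]
  · rw [letterRoot_append, cs.letterRoot_eq_simpleRoot h1 hi1, letterRoot, wordProd_cons, e,
      ← wordProd_cons]
  · rw [letterRoot, e, letterRoot]
  · rw [letterRoot_append, cs.letterRoot_eq_simpleRoot h2 hi2, letterRoot]

/-- The two braids share the root of the middle `j`, so their highest roots, those of `k` and `l`,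
would agree; but distinct positions of a reduced word have distinct roots. -/
theorem IsMaximallyClustered.avoidsAdjacentBraids {cs : CoxeterSystem M W} {w : W}
    (hw : cs.IsMaximallyClustered w) : cs.AvoidsAdjacentBraids w := by
  rintro a j y y' b hr rfl h1 h2
  obtain ⟨y₁, k, y₂, rfl, hk, hy₁, hy₂⟩ := exists_of_adjCount_eq_one h1
  obtain ⟨z₁, l, z₂, rfl, hl, hz₁, hz₂⟩ := exists_of_adjCount_eq_one h2
  have t1 := IsReduced.isBraidTriple (cs := cs) (a := a) (y₁ := y₁) (j := k) (y₂ := y₂)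
    (b := (z₁ ++ l :: z₂) ++ j :: b) (by simpa using hr) hk hy₁ hy₂
  have t2 := IsReduced.isBraidTriple (cs := cs) (a := a ++ j :: (y₁ ++ k :: y₂)) (y₁ := z₁)
    (j := l) (y₂ := z₂) (b := b) (by simpa using hr) hl hz₁ hz₂
  simp only [List.append_assoc, List.cons_append] at t1 t2 hw
  have he := hw.middle_eq t1 t2 rfl
  refine cs.letterRoot_ne (a := a ++ j :: y₁) (c := y₂ ++ j :: z₁) (i := k) (k := l)
    (b := z₂ ++ j :: b) (by simpa using hr) ?_
  simpa using he

end Triples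

end CoxeterSystem

/-! ### From reduced words of least letter sum to sparse words -/

namespace CoxeterMatrix

/-- Adjacency in the infinite graph consisting of the path `1 - 2 - 3 - ⋯` and the vertex `0`
joined to `3`. -/
def TypeEAdj (i j : ℕ) : Prop := typeEEdge i j ∨ typeEEdge j i

instance TypeEAdj.decidable (i j : ℕ) : Decidable (TypeEAdj i j) := by
  unfold TypeEAdj
  infer_instance

/-- The number of letters of `y` adjacent to `i`. -/
def typeEAdjCount (i : ℕ) (y : List ℕ) : ℕ := y.countP (fun k => TypeEAdj i k)

/-- The local constraints satisfied by a reduced word of minimal letter sum for an element of a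
Coxeter group of type `E` that avoids adjacent braids. -/
structure IsSparseWord (ν : List ℕ) : Prop where
  two_le : ∀ a i y b, ν = a ++ i :: (y ++ i :: b) → (∀ k ∈ y, TypeEAdj i k → k < i) →
    2 ≤ typeEAdjCount i y
  ne_one_of_right : ∀ a j y₀ i y₁ c₁ c₂, TypeEAdj i j →
    ν = a ++ j :: (y₀ ++ i :: (y₁ ++ j :: (c₁ ++ i :: c₂))) →
    typeEAdjCount i y₁ = 0 → typeEAdjCount i c₁ = 0 → typeEAdjCount j (y₀ ++ y₁) ≠ 1
  ne_one_of_left : ∀ a i c₁ j y₁ y₀ b, TypeEAdj i j →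
    ν = a ++ i :: (c₁ ++ j :: (y₁ ++ i :: (y₀ ++ j :: b))) →
    typeEAdjCount i y₁ = 0 → typeEAdjCount i c₁ = 0 → typeEAdjCount j (y₁ ++ y₀) ≠ 1
  ne_one_of_left_right : ∀ a i a₁ j y₀ y₁ y₂ c₁ c₂, TypeEAdj i j →
    ν = a ++ i :: (a₁ ++ j :: (y₀ ++ i :: (y₁ ++ i :: (y₂ ++ j :: (c₁ ++ i :: c₂))))) →
    typeEAdjCount i a₁ = 0 → typeEAdjCount i y₀ = 0 → typeEAdjCount i y₂ = 0 →
    typeEAdjCount i c₁ = 0 → typeEAdjCount j (y₀ ++ (y₁ ++ y₂)) ≠ 1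

theorem typeE_eq_three_iff {n : ℕ} (i j : Fin n) : typeE n i j = 3 ↔ TypeEAdj i j := by
  change (if i = j then 1 else if typeEEdge i j ∨ typeEEdge j i then 3 else 2) = 3 ↔ _
  unfold TypeEAdj
  split_ifs with h1 h2
  · subst h1
    simp [typeEEdge]
    omega
  · simp [h2]
  · simp [h2]

theorem typeEAdjCount_map {n : ℕ} (i : Fin n) (y : List (Fin n)) :
    typeEAdjCount i (y.map Fin.val) = (typeE n).adjCount i y := by
  simp only [typeEAdjCount, adjCount, List.countP_map]
  congr 1
  funext k
  simp [typeE_eq_three_iff]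

end CoxeterMatrix

namespace CoxeterSystem

variable {n : ℕ} {W : Type*} [Group W] {cs : CoxeterSystem (typeE n) W}

theorem AvoidsAdjacentBraids.isSparseWord {ω : List (Fin n)} (hr : cs.IsReduced ω)
    (hmin : ∀ ω', cs.IsReduced ω' → cs.wordProd ω' = cs.wordProd ω →
      (ω.map Fin.val).sum ≤ (ω'.map Fin.val).sum)
    (h : cs.AvoidsAdjacentBraids (cs.wordProd ω)) : IsSparseWord (ω.map Fin.val) where
  two_le := by
    intro a i y b he hlt
    simp only [List.map_eq_append_iff, List.map_eq_cons_iff] at he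
    obtain ⟨a, _, rfl, rfl, i, _, rfl, rfl, y, _, rfl, rfl, i', b, rfl, hi, rfl⟩ := he
    obtain rfl := Fin.val_injective hi
    rw [typeEAdjCount_map]
    by_contra hlt2
    have h0 := hr.adjCount_ne_zero
    obtain ⟨y₁, k, y₂, rfl, hk, h1, h2⟩ :=
      exists_of_adjCount_eq_one (i := i') (y := y) (M := typeE n) (by omega)
    have hki := hlt k (by simp) ((typeE_eq_three_iff _ _).1 hk)
    have e := cs.wordProd_flip a b hk h1 h2
    simp only [List.append_assoc, List.cons_append] at hr hmin
    -- Replacing `i k i` by `k i k` with `k < i` lowers the letter sum by `i - k`.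
    have := hmin _ (hr.of_wordProd_eq e (by simp; omega)) e.symm
    simp at this
    omega
  ne_one_of_right := by
    intro a j y₀ i y₁ c₁ c₂ hij he h1 h2
    simp only [List.map_eq_append_iff, List.map_eq_cons_iff] at he
    obtain ⟨a, _, rfl, rfl, j, _, rfl, rfl, y₀, _, rfl, rfl, i, _, rfl, rfl, y₁, _, rfl, rfl,
      j', _, rfl, hj, c₁, _, rfl, rfl, i', _, rfl, hi, rfl⟩ := he
    obtain rfl := Fin.val_injective hi
    obtain rfl := Fin.val_injective hj
    rw [typeEAdjCount_map] at h1 h2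
    rw [← List.map_append, typeEAdjCount_map]
    exact h.adjCount_ne_one_of_right hr ((typeE_eq_three_iff _ _).2 hij) h1 h2
  ne_one_of_left := by
    intro a i c₁ j y₁ y₀ b hij he h1 h2
    simp only [List.map_eq_append_iff, List.map_eq_cons_iff] at he
    obtain ⟨a, _, rfl, rfl, i, _, rfl, rfl, c₁, _, rfl, rfl, j, _, rfl, rfl, y₁, _, rfl, rfl,
      i', _, rfl, hi, y₀, _, rfl, rfl, j', _, rfl, hj, rfl⟩ := he
    obtain rfl := Fin.val_injective hi
    obtain rfl := Fin.val_injective hj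
    rw [typeEAdjCount_map] at h1 h2
    rw [← List.map_append, typeEAdjCount_map]
    exact h.adjCount_ne_one_of_left hr ((typeE_eq_three_iff _ _).2 hij) h1 h2
  ne_one_of_left_right := by
    intro a i a₁ j y₀ y₁ y₂ c₁ c₂ hij he h1 h2 h3 h4
    simp only [List.map_eq_append_iff, List.map_eq_cons_iff] at he
    obtain ⟨a, _, rfl, rfl, i, _, rfl, rfl, a₁, _, rfl, rfl, j, _, rfl, rfl, y₀, _, rfl, rfl,
      i', _, rfl, hi, y₁, _, rfl, rfl, i'', _, rfl, hi', y₂, _, rfl, rfl, j', _, rfl, hj,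
      c₁, _, rfl, rfl, i''', _, rfl, hi'', rfl⟩ := he
    obtain rfl := Fin.val_injective hi
    obtain rfl := Fin.val_injective hi'
    obtain rfl := Fin.val_injective hi''
    obtain rfl := Fin.val_injective hj
    rw [typeEAdjCount_map] at h1 h2 h3 h4
    rw [← List.map_append, ← List.map_append, typeEAdjCount_map]
    exact h.adjCount_ne_one_of_left_right hr ((typeE_eq_three_iff _ _).2 hij) h1 h2 h3 h4

end CoxeterSystem

/-! ### Combinatorics of sparse words -/

namespace CoxeterMatrix

open List

theorem exists_first_occurrence {j : ℕ} {z : List ℕ} (h : 0 < z.count j) :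
    ∃ p q, z = p ++ j :: q ∧ p.count j = 0 := by
  obtain ⟨p, q, rfl, hp⟩ := eq_append_cons_of_mem (count_pos_iff.1 h)
  exact ⟨p, q, rfl, count_eq_zero.2 hp⟩

theorem exists_last_occurrence {j : ℕ} {z : List ℕ} (h : 0 < z.count j) :
    ∃ p q, z = p ++ j :: q ∧ q.count j = 0 := by
  obtain ⟨p, q, hz, hp⟩ := exists_first_occurrence (j := j) (z := z.reverse) (by simpa using h)
  refine ⟨q.reverse, p.reverse, ?_, by simpa using hp⟩
  rw [← z.reverse_reverse, hz]
  simp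

/-- The number of letters of `y` that are adjacent to `i` and smaller than `i`. -/
def typeELowerCount (i : ℕ) (y : List ℕ) : ℕ := y.countP (fun k => TypeEAdj i k ∧ k < i)

theorem typeEAdjCount_append (i : ℕ) (x y : List ℕ) :
    typeEAdjCount i (x ++ y) = typeEAdjCount i x + typeEAdjCount i y :=
  countP_append

theorem typeELowerCount_append (i : ℕ) (x y : List ℕ) :
    typeELowerCount i (x ++ y) = typeELowerCount i x + typeELowerCount i y :=
  countP_append

theorem typeEAdjCount_cons (i k : ℕ) (y : List ℕ) :
    typeEAdjCount i (k :: y) = typeEAdjCount i y + if TypeEAdj i k then 1 else 0 := by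
  simp [typeEAdjCount, countP_cons]

theorem typeELowerCount_cons (i k : ℕ) (y : List ℕ) :
    typeELowerCount i (k :: y) = typeELowerCount i y + if TypeEAdj i k ∧ k < i then 1 else 0 := by
  simp [typeELowerCount, countP_cons]

theorem typeEAdjCount_zero (y : List ℕ) : typeEAdjCount 0 y = y.count 3 := by
  induction y with
  | nil => rfl
  | cons k y ih =>
    rw [typeEAdjCount_cons, count_cons, ih]
    have hk : TypeEAdj 0 k ↔ k = 3 := by
      unfold TypeEAdj typeEEdge
      omega
    simp only [hk, beq_iff_eq]

theorem typeEAdjCount_one (y : List ℕ) : typeEAdjCount 1 y = y.count 2 := by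
  induction y with
  | nil => rfl
  | cons k y ih =>
    rw [typeEAdjCount_cons, count_cons, ih]
    have hk : TypeEAdj 1 k ↔ k = 2 := by
      unfold TypeEAdj typeEEdge
      omega
    simp only [hk, beq_iff_eq]

theorem typeEAdjCount_two (y : List ℕ) : typeEAdjCount 2 y = y.count 1 + y.count 3 := by
  induction y with
  | nil => rfl
  | cons k y ih =>
    rw [typeEAdjCount_cons, count_cons, count_cons, ih]
    have hk : TypeEAdj 2 k ↔ k = 1 ∨ k = 3 := by
      unfold TypeEAdj typeEEdge
      omega
    simp only [hk, beq_iff_eq]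
    split_ifs <;> omega

theorem typeEAdjCount_of_three_le {i : ℕ} (hi : 3 ≤ i) (y : List ℕ) :
    typeEAdjCount i y = typeELowerCount i y + y.count (i + 1) := by
  induction y with
  | nil => rfl
  | cons k y ih =>
    rw [typeEAdjCount_cons, typeELowerCount_cons, count_cons, ih]
    have hk : TypeEAdj i k ↔ (TypeEAdj i k ∧ k < i) ∨ k = i + 1 := by
      unfold TypeEAdj typeEEdge
      omega
    simp only [if_congr hk rfl rfl, beq_iff_eq]
    split_ifs <;> grind

theorem typeELowerCount_three (y : List ℕ) :
    typeELowerCount 3 y = y.count 0 + y.count 2 := by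
  induction y with
  | nil => rfl
  | cons k y ih =>
    rw [typeELowerCount_cons, count_cons, count_cons, ih]
    have hk : (TypeEAdj 3 k ∧ k < 3) ↔ k = 0 ∨ k = 2 := by
      unfold TypeEAdj typeEEdge
      omega
    simp only [hk, beq_iff_eq]
    split_ifs <;> omega

theorem typeELowerCount_succ {i : ℕ} (hi : 3 ≤ i) (y : List ℕ) :
    typeELowerCount (i + 1) y = y.count i := by
  induction y with
  | nil => rfl
  | cons k y ih =>
    rw [typeELowerCount_cons, count_cons, ih]
    have hk : (TypeEAdj (i + 1) k ∧ k < i + 1) ↔ k = i := by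
      unfold TypeEAdj typeEEdge
      omega
    simp only [hk, beq_iff_eq]

namespace IsSparseWord

variable {ν : List ℕ}

theorem of_factor {x : List ℕ} (h : IsSparseWord ν) {p q : List ℕ} (he : ν = p ++ (x ++ q)) :
    IsSparseWord x where
  two_le a i y b hx := h.two_le (p ++ a) i y (b ++ q) (by simp [he, hx])
  ne_one_of_right a j y₀ i y₁ c₁ c₂ hij hx :=
    h.ne_one_of_right (p ++ a) j y₀ i y₁ c₁ (c₂ ++ q) hij (by simp [he, hx])
  ne_one_of_left a i c₁ j y₁ y₀ b hij hx :=
    h.ne_one_of_left (p ++ a) i c₁ j y₁ y₀ (b ++ q) hij (by simp [he, hx])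
  ne_one_of_left_right a i a₁ j y₀ y₁ y₂ c₁ c₂ hij hx :=
    h.ne_one_of_left_right (p ++ a) i a₁ j y₀ y₁ y₂ c₁ (c₂ ++ q) hij (by simp [he, hx])

theorem count_le_one_of_typeEAdjCount_eq_zero (h : IsSparseWord ν) {a z b : List ℕ} {i : ℕ}
    (he : ν = a ++ (z ++ b)) (hz : typeEAdjCount i z = 0) : z.count i ≤ 1 := by
  by_contra hc
  obtain ⟨p, q, rfl, hp⟩ := exists_first_occurrence (j := i) (z := z) (by omega)
  rw [count_append, count_cons_self] at hc
  obtain ⟨r, s, rfl, hr⟩ := exists_first_occurrence (j := i) (z := q) (by omega)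
  have h0 : typeEAdjCount i r = 0 := by
    simp only [typeEAdjCount_append, typeEAdjCount_cons] at hz
    omega
  have := h.two_le (a ++ p) i r (s ++ b) (by simp [he]) (fun k hk hadj => by
    have := countP_eq_zero.1 h0 k hk
    simp [hadj] at this)
  omega

/-- Without a `3`, two consecutive occurrences of `2` would need two letters `1` between them, and
these would have no `2` in between. -/
theorem count_two_le_one (h : IsSparseWord ν) {a z b : List ℕ}
    (he : ν = a ++ (z ++ b)) (hz : z.count 3 = 0) : z.count 2 ≤ 1 := by
  by_contra hc
  obtain ⟨p, q, rfl, hp⟩ := exists_first_occurrence (j := 2) (z := z) (by omega)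
  rw [count_append, count_cons_self] at hc
  obtain ⟨r, s, rfl, hr⟩ := exists_first_occurrence (j := 2) (z := q) (by omega)
  have h3 : r.count 3 = 0 := by
    simp only [count_append, count_cons] at hz
    omega
  have h2 := h.two_le (a ++ p) 2 r (s ++ b) (by simp [he]) (fun k hk hadj => by
    have := count_eq_zero.1 h3
    have : k ≠ 3 := by rintro rfl; exact this hk
    simp only [TypeEAdj, typeEEdge] at hadj
    omega)
  have h1 := h.count_le_one_of_typeEAdjCount_eq_zero (a := a ++ p ++ [2]) (z := r)
    (b := 2 :: s ++ b) (i := 1) (by simp [he]) (by rw [typeEAdjCount_one, hr])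
  rw [typeEAdjCount_two] at h2
  omega

theorem two_le_typeELowerCount (h : IsSparseWord ν) {a m b : List ℕ} {j : ℕ} (hj : 3 ≤ j)
    (he : ν = a ++ j :: (m ++ j :: b)) (hm : m.count (j + 1) = 0) :
    2 ≤ typeELowerCount j m := by
  have := h.two_le a j m b he (fun k hk hadj => by
    have h1 := count_eq_zero.1 hm
    have : k ≠ j + 1 := by rintro rfl; exact h1 hk
    simp only [TypeEAdj, typeEEdge] at hadj
    omega)
  rw [typeEAdjCount_of_three_le hj] at this
  omega

/-! ### Descent of interior gaps to the branch vertex -/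

/-- The word contains four consecutive occurrences of `j` whose middle gap contains no `j + 1`, and
whose outer gaps contain letters below `j` adjacent to `j`. -/
def HasInteriorGap (ν : List ℕ) (j : ℕ) : Prop :=
  ∃ a g₁ z g₂ b, ν = a ++ j :: (g₁ ++ j :: (z ++ j :: (g₂ ++ j :: b))) ∧
    g₁.count j = 0 ∧ z.count j = 0 ∧ g₂.count j = 0 ∧ z.count (j + 1) = 0 ∧
    0 < typeELowerCount j g₁ ∧ 0 < typeELowerCount j g₂

/-- The last `i` of `g₁`, the occurrences of `i` in `z` (at least two) and the first `i` of `g₂` are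
consecutive. Gaps between those in `z` contain no `i + 1`, hence at least two lower neighbours. Only
the two gaps across an `i + 1` may lack one, and then `i (i + 1) i` can be flipped there. -/
theorem HasInteriorGap.pred (h : IsSparseWord ν) {i : ℕ} (hi : 3 ≤ i)
    (hg : HasInteriorGap ν (i + 1)) : HasInteriorGap ν i := by
  obtain ⟨a, g₁, z, g₂, b, rfl, hg₁, hz, hg₂, hz', hl₁, hl₂⟩ := hg
  have hcz := h.two_le_typeELowerCount (by omega) (a := a ++ (i + 1) :: g₁) (m := z)
    (b := g₂ ++ (i + 1) :: b) (by simp) hz'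
  rw [typeELowerCount_succ hi] at hl₁ hl₂ hcz
  have hadj : TypeEAdj i (i + 1) := Or.inl (Or.inl ⟨by omega, rfl⟩)
  obtain ⟨p, q, rfl, hq⟩ := exists_last_occurrence hl₁
  obtain ⟨p', q', rfl, hp'⟩ := exists_first_occurrence hl₂
  obtain ⟨z₁, r₁, rfl, hz₁⟩ := exists_first_occurrence (j := i) (z := z) (by omega)
  simp only [count_append, count_cons_self, hz₁] at hcz
  obtain ⟨m₁, r₂, rfl, hm₁⟩ := exists_first_occurrence (j := i) (z := r₁) (by omega)
  have hne : (i == i + 1) = false := by simp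
  have hne' : (i == i + 1 + 1) = false := by simp; omega
  simp only [count_append, count_cons, hne, hne', Bool.false_eq_true, if_false, add_zero,
    Nat.add_eq_zero_iff] at hg₁ hg₂ hz hz'
  have outer_eq_zero : ∀ {x y : List ℕ}, x.count (i + 1) = 0 → y.count (i + 1) = 0 →
      ¬ 0 < typeELowerCount i (x ++ (i + 1) :: y) →
      typeEAdjCount i x = 0 ∧ typeEAdjCount i y = 0 := by
    intro x y hx hy hxy
    rw [typeELowerCount_append, typeELowerCount_cons] at hxy
    rw [typeEAdjCount_of_three_le hi, typeEAdjCount_of_three_le hi]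
    omega
  have adj_succ : ∀ x : List ℕ, typeEAdjCount (i + 1) x = x.count i + x.count (i + 1 + 1) := by
    intro x
    rw [typeEAdjCount_of_three_le (by omega), typeELowerCount_succ hi]
  -- With exactly two `i` in `z`, both crossing gaps must contain a lower neighbour: flipping across
  -- either one would leave a single neighbour of `i + 1` in the rest of `z`.
  by_cases hr₂ : r₂.count i = 0
  · have hT₁ : 0 < typeELowerCount i (q ++ (i + 1) :: z₁) := by
      by_contra hT
      obtain ⟨e1, e2⟩ := outer_eq_zero (by omega) (by omega) hT
      refine h.ne_one_of_left (a ++ (i + 1) :: p) i q (i + 1) z₁ (m₁ ++ i :: r₂)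
        ((p' ++ i :: q') ++ (i + 1) :: b) hadj (by simp) e2 e1 ?_
      rw [adj_succ]
      simp only [count_append, count_cons, hne', beq_self_eq_true, Bool.false_eq_true, if_false,
        if_true]
      omega
    have hT₂ : 0 < typeELowerCount i (r₂ ++ (i + 1) :: p') := by
      by_contra hT
      obtain ⟨e1, e2⟩ := outer_eq_zero (by omega) (by omega) hT
      refine h.ne_one_of_right (a ++ (i + 1) :: (p ++ i :: q)) (i + 1) (z₁ ++ i :: m₁) i r₂ p'
        (q' ++ (i + 1) :: b) hadj (by simp) e1 e2 ?_
      rw [adj_succ]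
      simp only [count_append, count_cons, hne', beq_self_eq_true, Bool.false_eq_true, if_false,
        if_true]
      omega
    refine ⟨a ++ (i + 1) :: p, q ++ (i + 1) :: z₁, m₁, r₂ ++ (i + 1) :: p', q' ++ (i + 1) :: b,
      by simp, ?_, hm₁, ?_, by omega, hT₁, hT₂⟩
    · simp [hq, hz₁]
    · simp [hr₂, hp']
  obtain ⟨m₂, r₃, rfl, hm₂⟩ := exists_first_occurrence (j := i) (z := r₂) (by omega)
  simp only [count_append, count_cons, hne, hne', Bool.false_eq_true, if_false, add_zero,
    Nat.add_eq_zero_iff] at hz hz'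
  have hl_m₁ := h.two_le_typeELowerCount hi (a := a ++ (i + 1) :: ((p ++ i :: q) ++ (i + 1) :: z₁))
    (m := m₁) (b := m₂ ++ i :: r₃ ++ (i + 1) :: ((p' ++ i :: q') ++ (i + 1) :: b)) (by simp)
    (by omega)
  have hl_m₂ := h.two_le_typeELowerCount hi
    (a := a ++ (i + 1) :: ((p ++ i :: q) ++ (i + 1) :: (z₁ ++ i :: m₁)))
    (m := m₂) (b := r₃ ++ (i + 1) :: ((p' ++ i :: q') ++ (i + 1) :: b)) (by simp)
    (by omega)
  -- With exactly three `i` in `z`, one good crossing gap suffices; if both failed, flipping on both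
  -- sides would leave only the middle `i` in `z`.
  by_cases hr₃ : r₃.count i = 0
  · by_cases hT₁ : 0 < typeELowerCount i (q ++ (i + 1) :: z₁)
    · exact ⟨a ++ (i + 1) :: p, q ++ (i + 1) :: z₁, m₁, m₂,
        r₃ ++ (i + 1) :: ((p' ++ i :: q') ++ (i + 1) :: b), by simp,
        by simp [hq, hz₁], hm₁, hm₂, by omega, hT₁, by omega⟩
    by_cases hT₂ : 0 < typeELowerCount i (r₃ ++ (i + 1) :: p')
    · exact ⟨a ++ (i + 1) :: ((p ++ i :: q) ++ (i + 1) :: z₁), m₁, m₂, r₃ ++ (i + 1) :: p',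
        q' ++ (i + 1) :: b, by simp, hm₁, hm₂,
        by simp [hr₃, hp'], by omega, by omega, hT₂⟩
    obtain ⟨e1, e2⟩ := outer_eq_zero (by omega) (by omega) hT₁
    obtain ⟨e3, e4⟩ := outer_eq_zero (by omega) (by omega) hT₂
    exfalso
    refine h.ne_one_of_left_right (a ++ (i + 1) :: p) i q (i + 1) z₁ (m₁ ++ i :: m₂) r₃ p'
        (q' ++ (i + 1) :: b) hadj (by simp) e1 e2 e3 e4 ?_
    rw [adj_succ]
    simp only [count_append, count_cons, hne', beq_self_eq_true, Bool.false_eq_true, if_false,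
      if_true]
    omega
  obtain ⟨m₃, r₄, rfl, hm₃⟩ := exists_first_occurrence (j := i) (z := r₃) (by omega)
  simp only [count_append, count_cons, hne, hne', Bool.false_eq_true, if_false, add_zero,
    Nat.add_eq_zero_iff] at hz hz'
  have hl_m₃ := h.two_le_typeELowerCount hi
    (a := a ++ (i + 1) :: ((p ++ i :: q) ++ (i + 1) :: (z₁ ++ i :: (m₁ ++ i :: m₂))))
    (m := m₃) (b := r₄ ++ (i + 1) :: ((p' ++ i :: q') ++ (i + 1) :: b)) (by simp)
    (by omega)
  -- With at least four `i` in `z`, the first four already form the configuration.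
  exact ⟨a ++ (i + 1) :: ((p ++ i :: q) ++ (i + 1) :: z₁), m₁, m₂, m₃,
    r₄ ++ (i + 1) :: ((p' ++ i :: q') ++ (i + 1) :: b), by simp, hm₁, hm₂, hm₃, by omega,
    by omega, by omega⟩

/-- The middle gap contains exactly one `0` and one `2`. Flips exclude `0` from the outer gaps, so
each contains a `2`; further flips force a `1` into each gap between the consecutive letters `2`
around the middle. The resulting pattern `2 1 2 1` is itself forbidden. -/
theorem not_hasInteriorGap_three (h : IsSparseWord ν) : ¬ HasInteriorGap ν 3 := by
  rintro ⟨a, g₁, z, g₂, b, rfl, hg₁, hz, hg₂, hz', hl₁, hl₂⟩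
  have hcz := h.two_le_typeELowerCount le_rfl (a := a ++ 3 :: g₁) (m := z) (b := g₂ ++ 3 :: b)
    (by simp) hz'
  rw [typeELowerCount_three] at hl₁ hl₂ hcz
  have hz0 := h.count_le_one_of_typeEAdjCount_eq_zero (a := a ++ 3 :: (g₁ ++ [3])) (z := z)
    (b := 3 :: (g₂ ++ 3 :: b)) (i := 0) (by simp) (by rw [typeEAdjCount_zero, hz])
  have hz2 := h.count_two_le_one (a := a ++ 3 :: (g₁ ++ [3])) (z := z)
    (b := 3 :: (g₂ ++ 3 :: b)) (by simp) hz
  have h03 : TypeEAdj 0 3 := Or.inl (Or.inr ⟨rfl, rfl⟩)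
  have h23 : TypeEAdj 2 3 := Or.inl (Or.inl ⟨by omega, rfl⟩)
  have h12 : TypeEAdj 1 2 := Or.inl (Or.inl ⟨by omega, rfl⟩)
  have adj_three : ∀ x, typeEAdjCount 3 x = x.count 0 + x.count 2 + x.count 4 := fun x => by
    rw [typeEAdjCount_of_three_le le_rfl, typeELowerCount_three]
  -- Otherwise flipping `0 3 0` would leave the `2` as the only neighbour of `3` in the middle gap.
  have hg₁0 : g₁.count 0 = 0 := by
    by_contra hc
    obtain ⟨p, q, rfl, hq⟩ := exists_last_occurrence (j := 0) (z := g₁) (by omega)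
    obtain ⟨z₁, z₂, rfl, hz₁⟩ := exists_first_occurrence (j := 0) (z := z) (by omega)
    simp [count_append] at hz0 hz2 hz hz' hg₁ hcz
    refine h.ne_one_of_left (a ++ 3 :: p) 0 q 3 z₁ z₂ (g₂ ++ 3 :: b) h03 (by simp) ?_ ?_ ?_
    · rw [typeEAdjCount_zero]; omega
    · rw [typeEAdjCount_zero]; omega
    · rw [adj_three, count_append, count_append, count_append]; omega
  have hg₂0 : g₂.count 0 = 0 := by
    by_contra hc
    obtain ⟨p, q, rfl, hp⟩ := exists_first_occurrence (j := 0) (z := g₂) (by omega)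
    obtain ⟨z₁, z₂, rfl, hz₂⟩ := exists_last_occurrence (j := 0) (z := z) (by omega)
    simp [count_append] at hz0 hz2 hz hz' hg₂ hcz
    refine h.ne_one_of_right (a ++ 3 :: g₁) 3 z₁ 0 z₂ p (q ++ 3 :: b) h03 (by simp) ?_ ?_ ?_
    · rw [typeEAdjCount_zero]; omega
    · rw [typeEAdjCount_zero]; omega
    · rw [adj_three, count_append, count_append, count_append]; omega
  obtain ⟨p, q, rfl, hq⟩ := exists_last_occurrence (j := 2) (z := g₁) (by omega)
  obtain ⟨p', q', rfl, hp'⟩ := exists_first_occurrence (j := 2) (z := g₂) (by omega)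
  obtain ⟨z₁, z₂, rfl, hz₁⟩ := exists_first_occurrence (j := 2) (z := z) (by omega)
  simp [count_append] at hz0 hz2 hz hz' hg₁ hg₂ hcz
  -- Otherwise flipping `2 3 2` would leave the `0` as the only neighbour of `3` in the middle gap.
  have hT₁ : 0 < (q ++ 3 :: z₁).count 1 := by
    by_contra hc
    simp [count_append] at hc
    refine h.ne_one_of_left (a ++ 3 :: p) 2 q 3 z₁ z₂ ((p' ++ 2 :: q') ++ 3 :: b) h23 (by simp)
      ?_ ?_ ?_
    · rw [typeEAdjCount_two, count_eq_zero.2 hc.2]; omega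
    · rw [typeEAdjCount_two, count_eq_zero.2 hc.1]; omega
    · rw [adj_three, count_append, count_append, count_append]; omega
  have hT₂ : 0 < (z₂ ++ 3 :: p').count 1 := by
    by_contra hc
    simp [count_append] at hc
    refine h.ne_one_of_right (a ++ 3 :: (p ++ 2 :: q)) 3 z₁ 2 z₂ p' (q' ++ 3 :: b) h23 (by simp)
      ?_ ?_ ?_
    · rw [typeEAdjCount_two, count_eq_zero.2 hc.1]; omega
    · rw [typeEAdjCount_two, count_eq_zero.2 hc.2]; omega
    · rw [adj_three, count_append, count_append, count_append]; omega
  have h2T₁ : (q ++ 3 :: z₁).count 2 = 0 := by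
    simp only [count_append, count_cons, hq, hz₁]; rfl
  have h2T₂ : (z₂ ++ 3 :: p').count 2 = 0 := by
    simp only [count_append, count_cons, hp']
    simp
    omega
  have h3T₁ : (q ++ 3 :: z₁).count 3 = 1 := by
    simp only [count_append, count_cons_self]
    omega
  have h1T₁ := h.count_le_one_of_typeEAdjCount_eq_zero (a := a ++ 3 :: (p ++ [2]))
    (z := q ++ 3 :: z₁) (b := 2 :: (z₂ ++ 3 :: ((p' ++ 2 :: q') ++ 3 :: b))) (i := 1)
    (by simp) (by rw [typeEAdjCount_one, h2T₁])
  obtain ⟨u, v, huv, hv⟩ := exists_last_occurrence hT₁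
  obtain ⟨u', v', huv', hu'⟩ := exists_first_occurrence hT₂
  rw [huv] at h2T₁ h3T₁ h1T₁
  rw [huv'] at h2T₂
  simp [count_append] at h2T₁ h3T₁ h1T₁ h2T₂
  -- Flipping `1 2 1` removes the only `1` from the first gap between letters `2`, leaving its
  -- single `3` as the only neighbour of `2`.
  refine h.ne_one_of_right (a ++ 3 :: p) 2 u 1 v u' (v' ++ 2 :: (q' ++ 3 :: b)) h12 ?_ ?_ ?_ ?_
  · have e : a ++ 3 :: p ++ 2 :: (u ++ 1 :: (v ++ 2 :: (u' ++ 1 :: (v' ++ 2 :: (q' ++ 3 :: b)))))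
        = a ++ 3 :: p ++ 2 :: ((u ++ 1 :: v) ++ 2 :: ((u' ++ 1 :: v') ++ 2 :: (q' ++ 3 :: b))) := by
      simp
    rw [e, ← huv, ← huv']
    simp
  · rw [typeEAdjCount_one]; exact h2T₁.2
  · rw [typeEAdjCount_one]; exact h2T₂.1
  · rw [typeEAdjCount_two, count_append, count_append]; omega

theorem not_hasInteriorGap (h : IsSparseWord ν) {j : ℕ} (hj : 3 ≤ j) : ¬ HasInteriorGap ν j := by
  induction j, hj using Nat.le_induction with
  | base => exact h.not_hasInteriorGap_three
  | succ i hi ih => exact fun hg => ih (hg.pred h hi)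

/-! ### Bounding the length of sparse words -/

/-- The largest letter of a sparse word occurs at most three times. -/
theorem count_le_three (h : IsSparseWord ν) {t : ℕ} (ht : ∀ k ∈ ν, k ≤ t) : ν.count t ≤ 3 := by
  have hzero : ∀ k, t < k → ν.count k = 0 := fun k hk =>
    count_eq_zero.2 fun hk' => by have := ht k hk'; omega
  rcases lt_or_ge t 3 with ht3 | ht3
  · interval_cases t
    · have := h.count_le_one_of_typeEAdjCount_eq_zero (a := []) (z := ν) (b := []) (i := 0)
        (by simp) (by rw [typeEAdjCount_zero, hzero 3 (by omega)])
      omega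
    · have := h.count_le_one_of_typeEAdjCount_eq_zero (a := []) (z := ν) (b := []) (i := 1)
        (by simp) (by rw [typeEAdjCount_one, hzero 2 (by omega)])
      omega
    · have := h.count_two_le_one (a := []) (z := ν) (b := []) (by simp) (hzero 3 (by omega))
      omega
  · by_contra hc
    have htop := hzero (t + 1) (by omega)
    -- As `t + 1` does not occur, every gap between two of four consecutive `t` contains at least
    -- two lower neighbours, so they form an interior gap.
    refine h.not_hasInteriorGap ht3 ?_
    obtain ⟨a, r, rfl, ha⟩ := exists_first_occurrence (j := t) (z := ν) (by omega)
    rw [count_append, count_cons_self] at hc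
    obtain ⟨g₁, r, rfl, hg₁⟩ := exists_first_occurrence (j := t) (z := r) (by omega)
    rw [count_append, count_cons_self] at hc
    obtain ⟨z, r, rfl, hz⟩ := exists_first_occurrence (j := t) (z := r) (by omega)
    rw [count_append, count_cons_self] at hc
    obtain ⟨g₂, b, rfl, hg₂⟩ := exists_first_occurrence (j := t) (z := r) (by omega)
    simp only [count_append, count_cons] at htop
    have h1 := h.two_le_typeELowerCount ht3 (a := a) (m := g₁) (b := z ++ t :: (g₂ ++ t :: b))
      rfl (by omega)
    have h2 := h.two_le_typeELowerCount ht3 (a := a ++ t :: (g₁ ++ t :: z)) (m := g₂) (b := b)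
      (by simp) (by omega)
    exact ⟨a, g₁, z, g₂, b, rfl, hg₁, hz, hg₂, by omega, by omega, by omega⟩

theorem length_le_of_count_le {t K r : ℕ}
    (hK : ∀ p x q, ν = p ++ (x ++ q) → x.count t = 0 → x.length ≤ K) (hr : ν.count t ≤ r) :
    ν.length ≤ (r + 1) * K + r := by
  induction r generalizing ν with
  | zero => simpa using hK [] ν [] (by simp) (by omega)
  | succ r ih =>
    by_cases h0 : ν.count t = 0
    · have := hK [] ν [] (by simp) h0
      nlinarith [Nat.zero_le (r * K)]
    · obtain ⟨p, q, rfl, hp⟩ := exists_first_occurrence (j := t) (z := ν) (by omega)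
      have h1 := hK [] p (t :: q) (by simp) hp
      rw [count_append, count_cons_self] at hr
      have h2 := ih (ν := q) (fun p' x q' he hx => hK (p ++ t :: p') x q' (by simp [he]) hx)
        (by omega)
      rw [length_append, length_cons]
      nlinarith

theorem exists_length_le (m : ℕ) :
    ∃ L, ∀ ν, IsSparseWord ν → (∀ k ∈ ν, k < m) → ν.length ≤ L := by
  induction m with
  | zero =>
    refine ⟨0, fun ν _ hν => ?_⟩
    rw [eq_nil_iff_forall_not_mem.2 fun k hk => Nat.not_lt_zero _ (hν k hk)]
    rfl
  | succ m ih =>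
    obtain ⟨L, hL⟩ := ih
    -- At most three occurrences of `m` cut the word into at most four factors over the letters
    -- below `m`.
    refine ⟨(3 + 1) * L + 3, fun ν h hν => ?_⟩
    refine length_le_of_count_le (t := m) (fun p x q he hx => ?_)
      (h.count_le_three fun k hk => Nat.le_of_lt_succ (hν k hk))
    refine hL x (h.of_factor he) fun k hk => ?_
    have h1 := hν k (by simp [he, hk])
    have h2 : k ≠ m := by rintro rfl; exact count_eq_zero.1 hx hk
    omega

end IsSparseWord

end CoxeterMatrix

/-! ### Finiteness of the set of maximally clustered elements -/

theorem CoxeterSystem.exists_isSparseWord {n : ℕ} {W : Type*} [Group W]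
    (cs : CoxeterSystem (typeE n) W) {w : W} (hw : cs.IsMaximallyClustered w) :
    ∃ ω : List (Fin n), cs.wordProd ω = w ∧ IsSparseWord (ω.map Fin.val) := by
  classical
  have hex : ∃ N, ∃ ω, cs.IsReduced ω ∧ cs.wordProd ω = w ∧ (ω.map Fin.val).sum = N := by
    obtain ⟨ω, hr, hω⟩ := cs.exists_isReduced w
    exact ⟨_, ω, hr, hω.symm, rfl⟩
  obtain ⟨ω, hr, rfl, hN⟩ := Nat.find_spec hex
  refine ⟨ω, rfl, hw.avoidsAdjacentBraids.isSparseWord hr fun ω' hr' he => ?_⟩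
  rw [hN]
  exact Nat.find_min' hex ⟨ω', hr', he, rfl⟩

theorem theorem7p2 (n : ℕ) (hn : 6 ≤ n) {W : Type*} [Group W]
    (cs : CoxeterSystem (CoxeterMatrix.typeE n) W) :
    {w : W | cs.IsMaximallyClustered w}.Finite := by
  obtain ⟨L, hL⟩ := CoxeterMatrix.IsSparseWord.exists_length_le n
  refine ((List.finite_length_le (Fin n) L).image cs.wordProd).subset fun w hw => ?_
  obtain ⟨ω, hω, hs⟩ := cs.exists_isSparseWord hw
  refine ⟨ω, ?_, hω⟩
  have := hL _ hs (by simp)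
  simpa using this
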